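/- Let $n$ be a positive integer and let $\pi=\pi_1\pi_2\cdots\pi_n\in\mathfrak S_n$ be a permutation of $\{1,\dots,n\}$, in one-line notation, that ends in $n1$, i.e. $n\ge 2$, $\pi_{n-1}=n$ and $\pi_n=1$ (an $Ln1$ permutation). For $\sigma\in\mathfrak S_n$ let $s(\sigma)$ be the output of one pass of the stack-sorting algorithm: start with an empty stack and read $\sigma_1,\dots,\sigma_n$ from left to right; when $\sigma_k$ is read, pop the top of the stack to the end of the output as long as the stack is non-empty and its top is smaller than $\sigma_k$, then push $\sigma_k$; after $\sigma_n$ has been read, pop all remaining entries to the output. Let $\mathcal S^\pi=\{\pi,s(\pi),s^2(\pi),\dots\}$, regard each permutation $\sigma$ as the point $(\sigma_1,\dots,\sigma_n)\in\mathbb R^n$, and let $\mathcal P=\operatorname{conv}(\mathcal S^\pi)\subset\mathbb R^n$ be the stack-sorting simplex generated by $\pi$. Then $\mathcal P$ contains at most $(n-1)!+(n-1)$ lattice points, that is, $$|\mathcal P\cap\mathbb Z^n|\le (n-1)!+(n-1).$$ -/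

import Mathlib

namespace StackSorting

/-- The stack-sorting algorithm run on the remaining input (first argument, read from left to right)
with the current stack (second argument, its head is the top of the stack). The result is the list
of all values still to be output. When `a` is read, values are popped from the stack to the output
as long as they are less than `a`; then `a` is pushed. When the input is exhausted, the stack is
emptied from the top. -/
def sortAux {α : Type*} [LinearOrder α] : List α → List α → List α
  | [], st => st
  | a :: l, st =>
      st.takeWhile (fun t => decide (t < a)) ++
        sortAux l (a :: st.dropWhile (fun t => decide (t < a)))

/-- One pass of the stack-sorting algorithm on a word, starting with the empty stack. -/
def sortList {α : Type*} [LinearOrder α] (l : List α) : List α := sortAux l []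

theorem sortAux_perm {α : Type*} [LinearOrder α] (l st : List α) :
    (sortAux l st).Perm (l ++ st) := by
  induction l generalizing st with
  | nil => simp [sortAux]
  | cons a l ih =>
    have h1 := (ih (a :: st.dropWhile (fun t => decide (t < a)))).append_left
      (st.takeWhile (fun t => decide (t < a)))
    refine h1.trans ?_
    refine List.perm_append_comm.trans ?_
    rw [List.append_assoc, List.cons_append]
    refine List.perm_middle.trans ?_
    refine List.Perm.cons a (List.Perm.append_left l ?_)
    refine List.perm_append_comm.trans ?_
    rw [List.takeWhile_append_dropWhile]

theorem sortList_perm {α : Type*} [LinearOrder α] (l : List α) : (sortList l).Perm l := by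
  simpa [sortList] using sortAux_perm l []

theorem length_sortList_ofFn {n : ℕ} (π : Equiv.Perm (Fin n)) :
    (sortList (List.ofFn π)).length = n := by
  rw [(sortList_perm _).length_eq, List.length_ofFn]

theorem nodup_sortList_ofFn {n : ℕ} (π : Equiv.Perm (Fin n)) :
    (sortList (List.ofFn π)).Nodup :=
  (sortList_perm _).nodup_iff.mpr (List.nodup_ofFn_ofInjective π.injective)

theorem bijective_sortList_ofFn {n : ℕ} (π : Equiv.Perm (Fin n)) :
    Function.Bijective fun i : Fin n =>
      (sortList (List.ofFn π)).get (i.cast (length_sortList_ofFn π).symm) :=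
  Finite.injective_iff_bijective.mp fun _ _ h =>
    Fin.cast_injective _ ((nodup_sortList_ofFn π).injective_get h)

/-- The stack-sorting map `s` on permutations: the one-line notation of `s π` is the result of one
pass of the algorithm on the one-line notation of `π` (values and positions in `Fin n`, that is,
shifted by one from `1, …, n`). -/
noncomputable def stackSort {n : ℕ} (π : Equiv.Perm (Fin n)) : Equiv.Perm (Fin n) :=
  Equiv.ofBijective _ (bijective_sortList_ofFn π)

/-- The one-line notation `π₁ π₂ ⋯ πₙ` of a permutation, with values in `{1, …, n}`. -/
def oneLine {n : ℕ} (π : Equiv.Perm (Fin n)) : List ℕ :=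
  List.ofFn fun i => (π i : ℕ) + 1

/-- A permutation of length `n` is an `Ln1` permutation if its one-line notation ends with the two
letters `n`, `1` (in particular `2 ≤ n`). -/
def IsLn1 {n : ℕ} (π : Equiv.Perm (Fin n)) : Prop :=
  [n, 1] <:+ oneLine π

/-- The point `(π₁, …, πₙ)` of `ℝⁿ` corresponding to a permutation. -/
def toPoint {n : ℕ} (π : Equiv.Perm (Fin n)) : Fin n → ℝ :=
  fun i => ((π i : ℕ) : ℝ) + 1

/-- The set `{π, s(π), s²(π), …}` of all permutations obtained from `π` by repeated passes of the
stack-sorting algorithm. -/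
def sortOrbit {n : ℕ} (π : Equiv.Perm (Fin n)) : Set (Equiv.Perm (Fin n)) :=
  Set.range fun k : ℕ => stackSort^[k] π

/-- The stack-sorting polytope of `π`. -/
def polytope {n : ℕ} (π : Equiv.Perm (Fin n)) : Set (Fin n → ℝ) :=
  convexHull ℝ (toPoint '' sortOrbit π)

/-- The integer lattice `ℤⁿ` in `ℝⁿ`. -/
def integerPoints (n : ℕ) : Set (Fin n → ℝ) :=
  {x | ∀ i, ∃ m : ℤ, x i = m}

end StackSorting

/-! Each pass on an `Ln1` permutation moves the letter 1 one place left and fixes every position to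
its right (`IsPartiallySorted.sortList`), until the identity is reached. With positions counted from
0, the orbit therefore gives vertices `v j` with entry 1 at position `j` and entry `i + 1` at each
`i > j`. For a point with barycentric weights `w`, coordinate `i` minus `i + 1` equals `-i * w i`
plus terms in `w j` with `j > i`. Hence the residues mod `i` of the coordinates of a lattice point
determine, from the last position down, every `w i` with `i ≠ 0` up to an integer
(`eq_of_residues_eq`). Lattice points with all these weights below 1 thus inject into a product of
`ZMod i` for `1 ≤ i ≤ n - 1`, of size `(n - 1)!`. The others are among the `n - 1` vertices `v j`
with `j ≠ 0`. -/

namespace StackSorting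

/-! ### Stack-sorting of words -/

section Words

variable {α β : Type*} [LinearOrder α] [LinearOrder β]

theorem sortAux_map {f : α → β} (hf : StrictMono f) (l st : List α) :
    sortAux (l.map f) (st.map f) = (sortAux l st).map f := by
  induction l generalizing st with
  | nil => simp [sortAux]
  | cons a l ih =>
    have hp : (fun t => decide (t < f a)) ∘ f = fun t => decide (t < a) := by
      funext t
      simp [hf.lt_iff_lt]
    simp only [List.map_cons, sortAux, List.takeWhile_map, List.dropWhile_map, hp, List.map_append]
    rw [← ih, List.map_cons]

theorem sortList_map {f : α → β} (hf : StrictMono f) (l : List α) :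
    sortList (l.map f) = (sortList l).map f :=
  sortAux_map hf l []

/-- Reading `a` empties the whole stack, so the two halves are processed independently. -/
theorem sortAux_append_cons_of_forall_lt {a : α} (l r st : List α)
    (hl : ∀ x ∈ l, x < a) (hst : ∀ x ∈ st, x < a) :
    sortAux (l ++ a :: r) st = sortAux l st ++ sortAux r [a] := by
  induction l generalizing st with
  | nil =>
    have h1 : st.takeWhile (fun t => decide (t < a)) = st :=
      List.takeWhile_eq_self_iff.2 fun x hx => by simpa using hst x hx
    have h2 : st.dropWhile (fun t => decide (t < a)) = [] :=
      List.dropWhile_eq_nil_iff.2 fun x hx => by simpa using hst x hx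
    simp [sortAux, h1, h2]
  | cons b l ih =>
    simp only [List.cons_append, sortAux, List.append_assoc]
    rw [ih _ fun x hx => hl x (by simp [hx])]
    intro x hx
    rcases List.mem_cons.1 hx with rfl | hx
    · exact hl _ (by simp)
    · exact hst x ((List.dropWhile_sublist _).subset hx)

/-- A bottom entry larger than all remaining input is never popped before the end. -/
theorem sortAux_append_stack_of_forall_lt {a : α} (l st : List α) (hl : ∀ x ∈ l, x < a) :
    sortAux l (st ++ [a]) = sortAux l st ++ [a] := by
  induction l generalizing st with
  | nil => simp [sortAux]
  | cons b l ih =>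
    have hb : ¬ a < b := (hl b (by simp)).le.not_gt
    have h : (st ++ [a]).takeWhile (fun t => decide (t < b)) =
          st.takeWhile (fun t => decide (t < b)) ∧
        (st ++ [a]).dropWhile (fun t => decide (t < b)) =
          st.dropWhile (fun t => decide (t < b)) ++ [a] := by
      clear ih
      induction st with
      | nil => simp [hb]
      | cons c st ih =>
        by_cases hc : c < b
        · simp [hc, ih]
        · simp [hc]
    rw [sortAux, sortAux, h.1, h.2, ← List.cons_append, ih _ fun x hx => hl x (by simp [hx]),
      List.append_assoc]

theorem sortAux_of_pairwise_lt (l st : List α) (hl : l.Pairwise (· < ·))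
    (h : ∀ x ∈ st, ∀ y ∈ l, x < y) : sortAux l st = st ++ l := by
  induction l generalizing st with
  | nil => simp [sortAux]
  | cons a l ih =>
    have := sortAux_append_cons_of_forall_lt [] l st (a := a) (by simp) fun x hx => h x hx a (by simp)
    rw [List.pairwise_cons] at hl
    rw [List.nil_append] at this
    rw [this, ih [a] hl.2 (by simpa using hl.1)]
    simp [sortAux]

/-- If `a` exceeds all other letters of a word, then one pass moves it to the end. -/
theorem sortList_append_cons_of_forall_lt {a : α} (l r : List α)
    (hl : ∀ x ∈ l, x < a) (hr : ∀ x ∈ r, x < a) :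
    sortList (l ++ a :: r) = sortList l ++ sortList r ++ [a] := by
  rw [sortList, sortAux_append_cons_of_forall_lt l r [] hl (by simp), List.append_assoc]
  congr 1
  exact sortAux_append_stack_of_forall_lt r [] hr

end Words

/-! ### The words that occur along the orbit -/

/-- The shape of the one-line notation after `k` passes on an `Ln1` permutation of length
`m + k + 2`. -/
def IsPartiallySorted (m k : ℕ) (l : List ℕ) : Prop :=
  ∃ M : List ℕ, M.Perm (List.range' 2 m) ∧ l = M ++ (m + 2) :: 1 :: List.range' (m + 3) k

theorem sortList_append_range' {m k : ℕ} {M : List ℕ} (hM : M.Perm (List.range' 2 m)) :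
    sortList (M ++ (m + 2) :: 1 :: List.range' (m + 3) k) =
      sortList M ++ 1 :: List.range' (m + 2) (k + 1) := by
  have hlt : ∀ x ∈ M, x < m + 2 := fun x hx => by
    have := hM.mem_iff.1 hx
    rw [List.mem_range'_1] at this
    omega
  rw [sortList, sortAux_append_cons_of_forall_lt M _ [] hlt (by simp)]
  congr 1
  -- The letter 1 lands on top of `m + 2`, so it leaves the stack first: this is its step to the
  -- left.
  have : sortAux (1 :: List.range' (m + 3) k) [m + 2] =
      sortAux (List.range' (m + 3) k) [1, m + 2] := by
    simp [sortAux]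
  rw [this, sortAux_of_pairwise_lt _ _ List.pairwise_lt_range']
  · simp [List.range'_succ]
  · simp only [List.mem_cons, List.mem_range'_1, List.not_mem_nil, or_false]
    intro x hx y hy
    omega

theorem IsPartiallySorted.sortList {m k : ℕ} {l : List ℕ} (h : IsPartiallySorted (m + 1) k l) :
    IsPartiallySorted m (k + 1) (sortList l) := by
  obtain ⟨M, hM, rfl⟩ := h
  -- The largest letter `m + 2` of `M` moves to the end of `M`, just before 1, which restores the
  -- shape.
  obtain ⟨L, R, rfl⟩ := List.append_of_mem (hM.mem_iff.2 (List.mem_range'_1.2 ⟨by omega, by omega⟩) :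
    m + 2 ∈ M)
  have hLR : (L ++ R).Perm (List.range' 2 m) := by
    refine List.Perm.cons_inv (a := m + 2) (List.perm_middle.symm.trans (hM.trans ?_))
    rw [List.range'_concat, mul_comm, mul_one, add_comm 2 m]
    exact List.perm_append_comm
  have hlt : ∀ x ∈ L ++ R, x < m + 2 := fun x hx => by
    have := hLR.mem_iff.1 hx
    rw [List.mem_range'_1] at this
    omega
  refine ⟨StackSorting.sortList L ++ StackSorting.sortList R,
    ((sortList_perm L).append (sortList_perm R)).trans hLR, ?_⟩
  rw [sortList_append_range' hM, sortList_append_cons_of_forall_lt L R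
    (fun x hx => hlt x (by simp [hx])) (fun x hx => hlt x (by simp [hx]))]
  simp

theorem IsPartiallySorted.sortList_zero {k : ℕ} {l : List ℕ} (h : IsPartiallySorted 0 k l) :
    StackSorting.sortList l = List.range' 1 (k + 2) := by
  obtain ⟨M, hM, rfl⟩ := h
  rw [sortList_append_range' hM]
  obtain rfl : M = [] := by simpa using hM
  simp [StackSorting.sortList, sortAux, List.range'_succ]

/-! ### From words to permutations -/

theorem oneLine_eq_map {n : ℕ} (π : Equiv.Perm (Fin n)) :
    oneLine π = (List.ofFn π).map fun i : Fin n => (i : ℕ) + 1 := by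
  simp [oneLine, List.map_ofFn, Function.comp_def]

theorem oneLine_stackSort {n : ℕ} (π : Equiv.Perm (Fin n)) :
    oneLine (stackSort π) = sortList (oneLine π) := by
  have hf : StrictMono fun i : Fin n => (i : ℕ) + 1 := fun i j h => by simpa using h
  rw [oneLine_eq_map, oneLine_eq_map, sortList_map hf]
  congr 1
  apply List.ext_getElem
  · simp [length_sortList_ofFn]
  · intro i h1 h2
    simp [stackSort]

theorem IsLn1.isPartiallySorted {m : ℕ} {π : Equiv.Perm (Fin (m + 2))} (h : IsLn1 π) :
    IsPartiallySorted m 0 (oneLine π) := by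
  obtain ⟨M, hM⟩ := h
  refine ⟨M, ?_, by simp [← hM]⟩
  have hperm : (oneLine π).Perm (List.range' 1 (m + 2)) := by
    rw [List.perm_ext_iff_of_nodup]
    · intro a
      simp only [oneLine, List.mem_ofFn, List.mem_range'_1]
      constructor
      · rintro ⟨i, rfl⟩
        have := (π i).2
        omega
      · intro ha
        refine ⟨π.symm ⟨a - 1, by omega⟩, ?_⟩
        simp
        omega
    · exact List.nodup_ofFn_ofInjective fun i j hij => π.injective (Fin.ext (by simpa using hij))
    · exact List.nodup_range'
  have h1 : List.range' 1 (m + 2) = 1 :: (List.range' 2 m ++ [m + 2]) := by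
    rw [List.range'_succ, List.range'_concat]
    simp [add_comm]
  have h2 : (1 :: (m + 2) :: M).Perm (1 :: (m + 2) :: List.range' 2 m) := by
    have h3 : (M ++ [m + 2, 1]).Perm (1 :: (m + 2) :: M) :=
      List.perm_append_comm.trans (List.Perm.swap _ _ _)
    refine h3.symm.trans ?_
    rw [hM]
    refine hperm.trans ?_
    rw [h1]
    exact List.Perm.cons _ List.perm_append_comm
  exact h2.cons_inv.cons_inv

theorem oneLine_iterate_stackSort {m : ℕ} {π : Equiv.Perm (Fin (m + 2))} (h : IsLn1 π) (k : ℕ) :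
    (∃ j, j + k = m ∧ IsPartiallySorted j k (oneLine (stackSort^[k] π))) ∨
      m < k ∧ oneLine (stackSort^[k] π) = List.range' 1 (m + 2) := by
  induction k with
  | zero => exact Or.inl ⟨m, rfl, h.isPartiallySorted⟩
  | succ k ih =>
    rw [Function.iterate_succ_apply', oneLine_stackSort]
    rcases ih with ⟨j, hj, hs⟩ | ⟨hk, hs⟩
    · cases j with
      | zero =>
        obtain rfl : k = m := by omega
        exact Or.inr ⟨by omega, hs.sortList_zero⟩
      | succ j => exact Or.inl ⟨j, by omega, hs.sortList⟩
    · refine Or.inr ⟨by omega, ?_⟩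
      rw [hs, sortList, sortAux_of_pairwise_lt _ _ List.pairwise_lt_range' (by simp)]
      simp

theorem getElem_oneLine {n : ℕ} (π : Equiv.Perm (Fin n)) (i : Fin n) :
    (oneLine π)[(i : ℕ)]? = some ((π i : ℕ) + 1) := by
  simp [oneLine]

theorem IsPartiallySorted.getElem?_succ {m k : ℕ} {l : List ℕ} (h : IsPartiallySorted m k l) :
    l[m + 1]? = some 1 := by
  obtain ⟨M, hM, rfl⟩ := h
  have hlen : M.length = m := by simpa using hM.length_eq
  rw [List.getElem?_append_right (by omega)]
  simp [hlen]

theorem IsPartiallySorted.getElem?_of_lt {m k i : ℕ} {l : List ℕ} (h : IsPartiallySorted m k l)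
    (h1 : m + 1 < i) (h2 : i < m + k + 2) : l[i]? = some (i + 1) := by
  obtain ⟨M, hM, rfl⟩ := h
  have hlen : M.length = m := by simpa using hM.length_eq
  obtain ⟨d, rfl⟩ : ∃ d, i = m + 2 + d := ⟨i - (m + 2), by omega⟩
  rw [List.getElem?_append_right (by omega), hlen, show m + 2 + d - m = d + 1 + 1 by omega,
    List.getElem?_cons_succ, List.getElem?_cons_succ, List.getElem?_range' (by omega)]
  congr 1
  omega

/-- Every permutation in the orbit of an `Ln1` permutation fixes all positions after that of the
letter `1`, and the position of the letter `1` determines the permutation. -/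
theorem exists_forall_mem_sortOrbit {m : ℕ} {π : Equiv.Perm (Fin (m + 2))} (h : IsLn1 π) :
    ∃ σ : Fin (m + 2) → Equiv.Perm (Fin (m + 2)),
      (∀ j, σ j j = 0) ∧ (∀ j i, j < i → σ j i = i) ∧ sortOrbit π ⊆ Set.range σ := by
  have key : ∀ k, k ≤ m ∧ (∃ j : Fin (m + 2), (j : ℕ) + k = m + 1 ∧ (stackSort^[k] π) j = 0 ∧
      ∀ i, j < i → (stackSort^[k] π) i = i) ∨ m < k ∧ stackSort^[k] π = 1 := by
    intro k
    rcases oneLine_iterate_stackSort h k with ⟨j, hj, hs⟩ | ⟨hk, hs⟩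
    · refine Or.inl ⟨by omega, ?_⟩
      refine ⟨⟨j + 1, by omega⟩, by simp; omega, ?_, ?_⟩
      · have := hs.getElem?_succ
        have h2 := getElem_oneLine (stackSort^[k] π) ⟨j + 1, by omega⟩
        simp only at h2
        rw [this] at h2
        simpa [Fin.ext_iff, eq_comm] using h2
      · intro i hi
        rw [Fin.lt_def] at hi
        have := hs.getElem?_of_lt (i := i) hi (by omega)
        rw [getElem_oneLine] at this
        simpa [Fin.ext_iff] using this
    · refine Or.inr ⟨hk, ?_⟩
      ext i
      have := getElem_oneLine (stackSort^[k] π) i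
      rw [hs, List.getElem?_range' (by omega)] at this
      simp at this
      simp
      omega
  -- The letter 1 starts at position `m` and index `0` is the value 1; the last position is `m + 1`,
  -- so `m + 1 - j` passes bring it to position `j`.
  have key' : ∀ j : Fin (m + 2), (stackSort^[m + 1 - (j : ℕ)] π) j = 0 ∧
      ∀ i, j < i → (stackSort^[m + 1 - (j : ℕ)] π) i = i := by
    intro j
    rcases key (m + 1 - j) with ⟨-, j', hj', h'⟩ | ⟨hlt, hk⟩
    · obtain rfl : j' = j := by
        ext
        omega
      exact h'
    · obtain rfl : j = 0 := by
        ext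
        simp only [Fin.val_zero]
        omega
      rw [hk]
      simp
  refine ⟨fun j => stackSort^[m + 1 - (j : ℕ)] π, fun j => (key' j).1, fun j => (key' j).2, ?_⟩
  rintro _ ⟨k, rfl⟩
  by_cases hk : k ≤ m + 1
  · refine ⟨⟨m + 1 - k, by omega⟩, ?_⟩
    simp only
    congr 2
    omega
  · refine ⟨0, ?_⟩
    have h1 : ∀ l, m < l → stackSort^[l] π = 1 := fun l hl =>
      (key l).elim (fun h => absurd h.1 hl.not_ge) And.right
    simp [h1 k (by omega), h1 (m + 1) (by omega)]

/-! ### Lattice points of a triangular simplex -/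

section Triangular

variable {m : ℕ} {v : Fin (m + 1) → Fin (m + 1) → ℝ}

theorem exists_stdSimplex_of_mem_convexHull_range {ι E : Type*} [Fintype ι] [AddCommGroup E]
    [Module ℝ E] {v : ι → E} {x : E} (hx : x ∈ convexHull ℝ (Set.range v)) :
    ∃ w ∈ stdSimplex ℝ ι, ∑ i, w i • v i = x := by
  classical
  have hv : Set.range v =
      Fintype.linearCombination ℝ v '' Set.range fun i : ι => Pi.single i (1 : ℝ) := by
    rw [← Set.range_comp]
    congr 1
    funext i
    simp
  rw [hv, ← LinearMap.image_convexHull, convexHull_rangle_single_eq_stdSimplex] at hx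
  exact hx

/-- Barycentric coordinates for a triangular family of vertices can be read off from the last
coordinate to the first. -/
theorem sum_smul_apply_sub (h1 : ∀ j, v j j = 1) (h2 : ∀ j i, j < i → v j i = (i : ℕ) + 1)
    {w : Fin (m + 1) → ℝ} (hw : ∑ j, w j = 1) (i : Fin (m + 1)) :
    (∑ j, w j • v j) i - ((i : ℕ) + 1) =
      -((i : ℕ) : ℝ) * w i + ∑ j ∈ Finset.Ioi i, w j * (v j i - ((i : ℕ) + 1)) := by
  have h : (∑ j, w j • v j) i - ((i : ℕ) + 1) = ∑ j, w j * (v j i - ((i : ℕ) + 1)) := by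
    simp only [mul_sub, Finset.sum_sub_distrib, ← Finset.sum_mul, hw, one_mul]
    simp
  rw [h, ← Finset.sum_subset (Finset.subset_univ (insert i (Finset.Ioi i))), Finset.sum_insert,
    h1]
  · ring
  · simp
  · intro j _ hj
    rw [h2 j i, sub_self, mul_zero]
    simp only [Finset.mem_insert, Finset.mem_Ioi, not_or, not_lt] at hj
    exact lt_of_le_of_ne hj.2 hj.1

/-- Downward induction: once the weights beyond `i` agree, coordinate `i` of the two points differs
by `i * (w' i - w i)`. So `w' i - w i` is an integer, and it lies strictly between -1 and 1. -/
theorem eq_of_residues_eq (h1 : ∀ j, v j j = 1) (h2 : ∀ j i, j < i → v j i = (i : ℕ) + 1)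
    {w w' : Fin (m + 1) → ℝ} (hw : w ∈ stdSimplex ℝ (Fin (m + 1)))
    (hw' : w' ∈ stdSimplex ℝ (Fin (m + 1)))
    (hlt : ∀ j, j ≠ 0 → w j < 1) (hlt' : ∀ j, j ≠ 0 → w' j < 1)
    (hres : ∀ i, i ≠ 0 → ∃ z : ℤ, (∑ j, w j • v j) i - (∑ j, w' j • v j) i = (i : ℕ) * z) : w = w' := by
  have main : ∀ i : Fin (m + 1), i ≠ 0 → w i = w' i := by
    intro i
    induction i using WellFoundedGT.induction with
    | ind i ih =>
      intro hi
      obtain ⟨z, hz⟩ := hres i hi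
      have e := sum_smul_apply_sub h1 h2 hw.2 i
      have e' := sum_smul_apply_sub h1 h2 hw'.2 i
      have hs : ∑ j ∈ Finset.Ioi i, w j * (v j i - ((i : ℕ) + 1)) =
          ∑ j ∈ Finset.Ioi i, w' j * (v j i - ((i : ℕ) + 1)) := by
        refine Finset.sum_congr rfl fun j hj => ?_
        rw [Finset.mem_Ioi] at hj
        rw [ih j hj (Fin.ne_zero_of_lt hj)]
      have hi' : ((i : ℕ) : ℝ) ≠ 0 := Nat.cast_ne_zero.2 (Fin.val_ne_zero_iff.2 hi)
      have hd : w' i - w i = z := by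
        apply mul_left_cancel₀ hi'
        linarith
      have a1 := hw.1 i
      have a2 := hw'.1 i
      have a3 := hlt i hi
      have a4 := hlt' i hi
      have z1 : (z : ℝ) < 1 := by linarith
      have z2 : (-1 : ℝ) < z := by linarith
      have z3 : z < 1 := by exact_mod_cast z1
      have z4 : -1 < z := by exact_mod_cast z2
      obtain rfl : z = 0 := by omega
      simp only [Int.cast_zero] at hd
      linarith
  -- Position 0 has modulus 0 and gives no information; its weight follows from the total being 1.
  funext i
  by_cases hi : i = 0
  · subst hi
    have e := hw.2
    have e' := hw'.2
    rw [Fin.sum_univ_succ] at e e'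
    have : ∑ j : Fin m, w j.succ = ∑ j : Fin m, w' j.succ :=
      Finset.sum_congr rfl fun j _ => main _ (Fin.succ_ne_zero j)
    linarith
  · exact main i hi

theorem sum_smul_eq_of_one_le {ι E : Type*} [Fintype ι] [AddCommGroup E] [Module ℝ E]
    (v : ι → E) {w : ι → ℝ} (hw : w ∈ stdSimplex ℝ ι) {i : ι} (hi : 1 ≤ w i) :
    ∑ j, w j • v j = v i := by
  classical
  have hsum := hw.2
  rw [← Finset.add_sum_erase _ _ (Finset.mem_univ i)] at hsum
  have hnn : ∀ j ∈ Finset.univ.erase i, 0 ≤ w j := fun j _ => hw.1 j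
  have h0 := Finset.sum_nonneg hnn
  have hz := (Finset.sum_eq_zero_iff_of_nonneg hnn).1 (by linarith)
  rw [Finset.sum_eq_single i]
  · rw [show w i = 1 by linarith, one_smul]
  · intro j _ hj
    rw [hz j (by simp [hj]), zero_smul]
  · simp

theorem finite_and_ncard_inter_integerPoints_le (h1 : ∀ j, v j j = 1)
    (h2 : ∀ j i, j < i → v j i = (i : ℕ) + 1) :
    (convexHull ℝ (Set.range v) ∩ integerPoints (m + 1)).Finite ∧
      (convexHull ℝ (Set.range v) ∩ integerPoints (m + 1)).ncard ≤ m.factorial + m := by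
  -- The vertex `v 0` is left out because the bound `w j < 1` in `S` is only asked for `j ≠ 0`.
  set A : Set (Fin (m + 1) → ℝ) := Set.range fun j : Fin m => v j.succ
  set S : Set (Fin (m + 1) → ℝ) := {x | x ∈ integerPoints (m + 1) ∧
    ∃ w ∈ stdSimplex ℝ (Fin (m + 1)), (∀ j, j ≠ 0 → w j < 1) ∧ ∑ j, w j • v j = x}
  have hsub : convexHull ℝ (Set.range v) ∩ integerPoints (m + 1) ⊆ S ∪ A := by
    rintro x ⟨hx, hint⟩
    obtain ⟨w, hw, rfl⟩ := exists_stdSimplex_of_mem_convexHull_range hx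
    by_cases hlt : ∀ j, j ≠ 0 → w j < 1
    · exact Or.inl ⟨hint, w, hw, hlt, rfl⟩
    · push Not at hlt
      obtain ⟨j, hj, hj1⟩ := hlt
      obtain ⟨j, rfl⟩ := Fin.exists_succ_eq.2 hj
      exact Or.inr ⟨j, (sum_smul_eq_of_one_le v hw hj1).symm⟩
  -- The modulus `i + 1` is the position `i.succ`; the floor only turns an integral real coordinate
  -- into an integer.
  let f : (Fin (m + 1) → ℝ) → (i : Fin m) → ZMod ((i : ℕ) + 1) := fun x i => (⌊x i.succ⌋ : ℤ)
  have hf : Set.InjOn f S := by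
    rintro _ ⟨hx, w, hw, hlt, rfl⟩ _ ⟨hx', w', hw', hlt', rfl⟩ he
    rw [eq_of_residues_eq h1 h2 hw hw' hlt hlt']
    intro i hi
    obtain ⟨a, ha⟩ := hx i
    obtain ⟨b, hb⟩ := hx' i
    rw [ha, hb]
    obtain ⟨i, rfl⟩ := Fin.exists_succ_eq.2 hi
    have := congr_fun he i
    simp only [f, ha, hb, Int.floor_intCast] at this
    rw [eq_comm, ZMod.intCast_eq_intCast_iff_dvd_sub] at this
    obtain ⟨z, hz⟩ := this
    refine ⟨z, ?_⟩
    rw [← Int.cast_sub, hz]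
    simp
  have hSfin : S.Finite := Set.Finite.of_injOn (Set.mapsTo_univ f S) hf Set.finite_univ
  have hcard : S.ncard ≤ m.factorial := by
    have := Set.ncard_le_ncard_of_injOn f (fun x _ => Set.mem_univ (f x)) hf Set.finite_univ
    rw [Set.ncard_univ, Nat.card_pi] at this
    refine this.trans_eq ?_
    simp only [Nat.card_zmod]
    rw [Fin.prod_univ_eq_prod_range (fun i => i + 1), Finset.prod_range_add_one_eq_factorial]
  have hA : A.ncard ≤ m := by
    have := Finite.card_range_le fun j : Fin m => v j.succ
    rwa [Nat.card_coe_set_eq, Nat.card_eq_fintype_card, Fintype.card_fin] at this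
  have hfin : (S ∪ A).Finite := hSfin.union (Set.finite_range _)
  exact ⟨hfin.subset hsub, (Set.ncard_le_ncard hsub hfin).trans
    ((Set.ncard_union_le S A).trans (Nat.add_le_add hcard hA))⟩

end Triangular

theorem IsLn1.two_le {n : ℕ} {π : Equiv.Perm (Fin n)} (h : IsLn1 π) : 2 ≤ n := by
  simpa [oneLine] using h.length_le

end StackSorting

theorem proposition5p4 {n : ℕ} (π : Equiv.Perm (Fin n)) (hπ : StackSorting.IsLn1 π) :
    (StackSorting.polytope π ∩ StackSorting.integerPoints n).Finite ∧
      (StackSorting.polytope π ∩ StackSorting.integerPoints n).ncard ≤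
        Nat.factorial (n - 1) + (n - 1) := by
  obtain ⟨m, rfl⟩ : ∃ m, n = m + 2 := ⟨n - 2, by have := hπ.two_le; omega⟩
  obtain ⟨σ, h0, h1, hσ⟩ := StackSorting.exists_forall_mem_sortOrbit hπ
  have hmain := StackSorting.finite_and_ncard_inter_integerPoints_le (m := m + 1)
    (v := fun j => StackSorting.toPoint (σ j))
    (fun j => by simp [StackSorting.toPoint, h0])
    (fun j i hij => by simp [StackSorting.toPoint, h1 j i hij])
  have hsub : StackSorting.polytope π ∩ StackSorting.integerPoints (m + 2) ⊆
      convexHull ℝ (Set.range fun j => StackSorting.toPoint (σ j)) ∩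
        StackSorting.integerPoints (m + 2) := by
    refine Set.inter_subset_inter_left _ (convexHull_mono ?_)
    rintro _ ⟨τ, hτ, rfl⟩
    obtain ⟨j, rfl⟩ := hσ hτ
    exact ⟨j, rfl⟩
  exact ⟨hmain.1.subset hsub, (Set.ncard_le_ncard hsub hmain.1).trans hmain.2⟩
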